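/- Let $K$ be a field and let $n_1<n_2<n_3<n_4$ be positive integers with $\gcd(n_1,n_2,n_3,n_4)=1$. Let $C$ be the monomial curve $x_i=t^{n_i}$ $(1\le i\le 4)$ in $\mathbb{A}^4(K)$, and let $I(C)$ be its toric ideal, i.e. the kernel of the $K$-algebra homomorphism $K[x_1,x_2,x_3,x_4]\to K[t]$, $x_i\mapsto t^{n_i}$. Suppose that $I(C)$ is given as in Gorenstein case 3(a), that is, there are integers $a_i$ and $0<a_{ij}<a_j$ such that $I(C)$ is generated by $$f_1=x_1^{a_1}-x_2^{a_{12}}x_4^{a_{14}},\quad f_2=x_2^{a_2}-x_1^{a_{21}}x_3^{a_{23}},\quad f_3=x_3^{a_3}-x_1^{a_{31}}x_4^{a_{34}},$$ $$f_4=x_4^{a_4}-x_2^{a_{42}}x_3^{a_{43}},\quad f_5=x_1^{a_{31}}x_2^{a_{42}}-x_3^{a_{23}}x_4^{a_{14}}.$$ Then $C$ has Cohen–Macaulay tangent cone at the origin if and only if $a_2\le a_{21}+a_{23}$ and $a_3\le a_{31}+a_{34}$. Here the tangent cone of $C$ at the origin has coordinate ring $K[x_1,x_2,x_3,x_4]/I(C)_*$,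 where $I(C)_*$ is the ideal generated by the homogeneous summands of least degree $f_*$ of all $f\in I(C)$, and it is called Cohen–Macaulay if this ring is a Cohen–Macaulay ring. -/

import Mathlib

open MvPolynomial

namespace MonomialCurve

noncomputable section

/-- The toric ideal `I(C)` of the monomial curve `x_i = t^(n_i)`: the kernel of the `K`-algebra
homomorphism `K[x_1, …, x_d] → K[t]`, `x_i ↦ t^(n_i)`. -/
def toricIdeal (K : Type*) [Field K] {d : ℕ} (n : Fin d → ℕ) : Ideal (MvPolynomial (Fin d) K) :=
  RingHom.ker (aeval (fun i => (Polynomial.X : Polynomial K) ^ n i) :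
    MvPolynomial (Fin d) K →ₐ[K] Polynomial K)

/-- The homogeneous summand of `f` of least degree (for the standard grading); it is `0` if
`f = 0`. -/
def initialForm {K : Type*} [Field K] {d : ℕ} (f : MvPolynomial (Fin d) K) :
    MvPolynomial (Fin d) K :=
  homogeneousComponent (sInf {k : ℕ | homogeneousComponent k f ≠ 0}) f

/-- The ideal `I_*` generated by the initial forms of all elements of `I`. -/
def initialFormIdeal {K : Type*} [Field K] {d : ℕ} (I : Ideal (MvPolynomial (Fin d) K)) :
    Ideal (MvPolynomial (Fin d) K) :=
  Ideal.span {g | ∃ f ∈ I, g = initialForm f}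

/-- The coordinate ring `K[x_1, …, x_d] / I(C)_*` of the tangent cone at the origin of the
monomial curve `C`. -/
abbrev TangentConeRing (K : Type*) [Field K] {d : ℕ} (n : Fin d → ℕ) : Type _ :=
  MvPolynomial (Fin d) K ⧸ initialFormIdeal (toricIdeal K n)

/-- The depth of a local ring: the supremum of the lengths of regular sequences contained in the
maximal ideal. -/
def localDepth (R : Type*) [CommRing R] [IsLocalRing R] : ℕ∞ :=
  sSup {k : ℕ∞ | ∃ rs : List R, (∀ r ∈ rs, r ∈ IsLocalRing.maximalIdeal R) ∧
    RingTheory.Sequence.IsRegular R rs ∧ k = (rs.length : ℕ∞)}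

/-- A commutative ring is Cohen–Macaulay if it is Noetherian and each of its localizations at a
maximal ideal has depth equal to its Krull dimension. -/
def IsCohenMacaulayRing (R : Type*) [CommRing R] : Prop :=
  IsNoetherianRing R ∧ ∀ (m : Ideal R) [m.IsMaximal],
    (localDepth (Localization.AtPrime m) : WithBot ℕ∞) = ringKrullDim (Localization.AtPrime m)

/-- The monomial curve `x_i = t^(n_i)` has Cohen–Macaulay tangent cone at the origin. -/
def HasCohenMacaulayTangentCone (K : Type*) [Field K] {d : ℕ} (n : Fin d → ℕ) : Prop :=
  IsCohenMacaulayRing (TangentConeRing K n)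

end

end MonomialCurve

/-! Call a monomial maximal if no monomial of the same weight `∑ uᵢ nᵢ` has larger degree.
Non-maximal monomials lie in `I(C)_*`, and maximal monomials of equal weight are congruent modulo
it. Hence the tangent cone ring has a basis indexed by the weights of monomials
(`mem_initialFormIdeal_iff`). Up to nilpotents this ring is `K[x₁]`, so it is one-dimensional, and
it is Cohen–Macaulay exactly when `x₁` is a nonzerodivisor, that is, when multiplication by `x₁`
preserves maximality (`hasCohenMacaulayTangentCone_iff`).

The rest is combinatorics of factorizations (`isLongest_add_iff`). Since `f₁, …, f₅` generate
`I(C)`, monomials of equal weight are connected by exchanging the two terms of these binomials.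
Necessity: no exchange applies to `x₃^a₂₃` or `x₄^a₃₄`, so they are maximal; multiplied by `x₁^a₂₁`
and `x₁^a₃₁` they get the weights of `x₂^a₂` and `x₃^a₃`, which therefore cannot be longer.
Sufficiency: the inequalities orient all five exchanges so that none shortens a factorization, and
the process ends in a normal form. If a normal form lacks `x₁`, so does every monomial of its
weight. Thus each competitor of `x₁ m` is at most as long as a multiple of `x₁`, and cancelling `x₁`
reduces to the maximality of `m`. -/

namespace MonomialCurve

/-! ### Cohen–Macaulayness of rings that are `K[t]` up to nilpotents -/

section OneDimensional

variable {K R : Type*} [Field K] [CommRing R] (ρ : R →+* Polynomial K)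

/-- The nil ideal `ker ρ` is prime and lies in every prime, so primes of `R` correspond to primes of
`K[t]`. It is not maximal because `K[t]` is not a field. -/
theorem ringKrullDim_localization_eq_one (hsurj : Function.Surjective ρ)
    (hnil : ∀ r, ρ r = 0 → IsNilpotent r) (m : Ideal R) [hm : m.IsMaximal] :
    ringKrullDim (Localization.AtPrime m) = 1 := by
  rw [IsLocalization.AtPrime.ringKrullDim_eq_height m]
  have hker : ∀ p : Ideal R, p.IsPrime → RingHom.ker ρ ≤ p := fun p hp r hr => by
    obtain ⟨k, hk⟩ := hnil r hr
    exact hp.mem_of_pow_mem k (hk ▸ p.zero_mem)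
  have hprime : (RingHom.ker ρ).IsPrime := RingHom.ker_isPrime ρ
  have hdim : ringKrullDim R ≤ 1 := by
    have h1 : ringKrullDim (R ⧸ RingHom.ker ρ) = ringKrullDim (Polynomial K) :=
      ringKrullDim_eq_of_ringEquiv (RingHom.quotientKerEquivOfSurjective hsurj)
    rw [Polynomial.ringKrullDim_of_isNoetherianRing, ringKrullDim_eq_zero_of_field, zero_add,
      ringKrullDim_quotient] at h1
    rw [← h1]
    exact Order.krullDim_le_of_strictMono
      (fun p => (⟨p, hker p.asIdeal p.isPrime⟩ :
        PrimeSpectrum.zeroLocus (R := R) (RingHom.ker ρ : Set R))) (fun _ _ h => h)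
  refine le_antisymm ((Ideal.height_le_ringKrullDim_of_ne_top hm.ne_top).trans hdim) ?_
  have hlt : RingHom.ker ρ < m := by
    refine lt_of_le_of_ne (hker m hm.isPrime) fun h => ?_
    have : (RingHom.ker ρ).IsMaximal := h ▸ hm
    have hf : IsField (R ⧸ RingHom.ker ρ) :=
      (Ideal.Quotient.maximal_ideal_iff_isField_quotient _).1 this
    exact Polynomial.not_isField K
      ((RingHom.quotientKerEquivOfSurjective hsurj).symm.toMulEquiv.isField hf)
  have := Ideal.height_add_one_le_of_lt_of_isPrime hlt
  have h2 : (1 : ℕ∞) ≤ m.height := le_trans (by simp) this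
  exact_mod_cast h2

theorem isCohenMacaulayRing_of_section [IsNoetherianRing R]
    (hnil : ∀ r, ρ r = 0 → IsNilpotent r) (σ : Polynomial K →+* R)
    (hσ : ∀ p, ρ (σ p) = p) (hreg : ∀ p, p ≠ 0 → ∀ r, σ p * r = 0 → r = 0) :
    IsCohenMacaulayRing R := by
  have hsurj : Function.Surjective ρ := fun p => ⟨σ p, hσ p⟩
  refine ⟨inferInstance, fun m hm => ?_⟩
  have hdim := ringKrullDim_localization_eq_one ρ hsurj hnil m
  have : IsNoetherianRing (Localization.AtPrime m) :=
    IsLocalization.isNoetherianRing m.primeCompl _ inferInstance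
  rw [hdim]
  suffices h : localDepth (Localization.AtPrime m) = 1 by rw [h]; rfl
  refine le_antisymm (sSup_le ?_) (le_sSup ?_)
  · rintro _ ⟨rs, -, hr, rfl⟩
    have h1 := ringKrullDim_add_length_eq_ringKrullDim_of_isRegular rs hr
    rw [hdim] at h1
    have hne : Nontrivial (Localization.AtPrime m ⧸ Ideal.ofList rs) := by
      refine Ideal.Quotient.nontrivial_iff.2 fun h => hr.top_ne_smul ?_
      rw [h]; simp
    have h2 : (0 : WithBot ℕ∞) ≤ ringKrullDim (Localization.AtPrime m ⧸ Ideal.ofList rs) :=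
      ringKrullDim_nonneg_of_nontrivial
    have h3 : ((rs.length : ℕ∞) : WithBot ℕ∞) ≤ 1 := by
      rw [← h1]
      exact le_add_of_nonneg_left h2
    exact_mod_cast h3
  -- Such a `y` differs from `σ (ρ y)` by a nilpotent, so `σ (ρ y)` is a nonzerodivisor in `m`.
  · obtain ⟨y, hy, hy0⟩ : ∃ y ∈ m, ρ y ≠ 0 := by
      by_contra! hcon
      have hk : RingHom.ker ρ = m :=
        (hm.eq_of_le (RingHom.ker_isPrime ρ).ne_top fun y hy => hcon y hy).symm
      have : (RingHom.ker ρ).IsMaximal := hk ▸ hm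
      have hf : IsField (R ⧸ RingHom.ker ρ) :=
        (Ideal.Quotient.maximal_ideal_iff_isField_quotient _).1 this
      exact Polynomial.not_isField K
        ((RingHom.quotientKerEquivOfSurjective hsurj).symm.toMulEquiv.isField hf)
    have hmem : σ (ρ y) ∈ m := by
      have : y - σ (ρ y) ∈ m := by
        obtain ⟨k, hk⟩ := hnil (y - σ (ρ y)) (by rw [map_sub, hσ, sub_self])
        exact hm.isPrime.mem_of_pow_mem k (hk ▸ m.zero_mem)
      simpa using m.sub_mem hy this
    set z := σ (ρ y) with hz
    have hweak : RingTheory.Sequence.IsWeaklyRegular R [z] := by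
      rw [RingTheory.Sequence.isWeaklyRegular_singleton_iff,
        isSMulRegular_iff_right_eq_zero_of_smul]
      exact hreg _ hy0
    refine ⟨[algebraMap R _ z], ?_,
      hweak.isRegular_of_isLocalization_of_mem (Localization.AtPrime m) m (by simpa using hmem),
      by simp⟩
    simpa only [List.mem_singleton, forall_eq] using
      (IsLocalization.AtPrime.to_map_mem_maximal_iff (Localization.AtPrime m) m z).2 hmem

theorem regular_of_isCohenMacaulayRing (hCM : IsCohenMacaulayRing R)
    (hnil : ∀ r, ρ r = 0 → IsNilpotent r) (σ : Polynomial K →+* R)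
    (hσ : ∀ p, ρ (σ p) = p) (f : R) (hf : σ Polynomial.X * f = 0) : f = 0 := by
  have hsurj : Function.Surjective ρ := fun p => ⟨σ p, hσ p⟩
  let m : Ideal R := Ideal.comap ρ (Ideal.span {Polynomial.X})
  have hXmax : (Ideal.span {(Polynomial.X : Polynomial K)}).IsMaximal :=
    PrincipalIdealRing.isMaximal_of_irreducible Polynomial.irreducible_X
  have hm : m.IsMaximal := Ideal.comap_isMaximal_of_surjective ρ hsurj
  have hdim := ringKrullDim_localization_eq_one ρ hsurj hnil m
  have hdepth := hCM.2 m
  rw [hdim] at hdepth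
  have hdepth : localDepth (Localization.AtPrime m) = 1 := by exact_mod_cast hdepth
  obtain ⟨_, ⟨rs, hrs, hreg, rfl⟩, hlt⟩ := lt_sSup_iff.1
    (show (0 : ℕ∞) < localDepth (Localization.AtPrime m) by rw [hdepth]; exact one_pos)
  -- Modulo nilpotents, `y` is a multiple of `σ X`, which kills `f`. A regular element of the
  -- maximal ideal then forces `f` to vanish in the localization.
  have kill : ∀ y ∈ m, ∃ k : ℕ, y ^ k * f = 0 := by
    intro y hy
    obtain ⟨q, hq⟩ := Ideal.mem_span_singleton.1 (Ideal.mem_comap.1 hy)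
    obtain ⟨k, hk⟩ := hnil (y - σ (ρ y)) (by rw [map_sub, hσ, sub_self])
    have h1 : y * f = (y - σ (ρ y)) * f := by
      rw [sub_mul, hq, map_mul, mul_right_comm, hf, zero_mul, sub_zero]
    have h2 : ∀ j : ℕ, y ^ j * f = (y - σ (ρ y)) ^ j * f := by
      intro j
      induction j with
      | zero => simp
      | succ j ih => rw [pow_succ, mul_assoc, h1, mul_left_comm, ih, pow_succ]; ring
    exact ⟨k, by rw [h2, hk, zero_mul]⟩
  have hloc : algebraMap R (Localization.AtPrime m) f = 0 := by
    obtain _ | ⟨r, rs⟩ := rs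
    · simp at hlt
    rw [RingTheory.Sequence.isRegular_cons_iff] at hreg
    have hr : r ∈ IsLocalRing.maximalIdeal (Localization.AtPrime m) := hrs r (by simp)
    obtain ⟨y, s, rfl⟩ := IsLocalization.exists_mk'_eq m.primeCompl r
    have hy : y ∈ m := (IsLocalization.AtPrime.mk'_mem_maximal_iff _ m y s).1 hr
    obtain ⟨k, hk⟩ := kill y hy
    have hreg' := hreg.1.pow k
    rw [isSMulRegular_iff_right_eq_zero_of_smul] at hreg'
    apply hreg'
    rw [smul_eq_mul, ← IsLocalization.mk'_pow, ← IsLocalization.mk'_one (M := m.primeCompl),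
      ← IsLocalization.mk'_mul, hk, IsLocalization.mk'_zero]
  obtain ⟨⟨s, hs⟩, hsf⟩ := (IsLocalization.map_eq_zero_iff m.primeCompl _ f).1 hloc
  -- From `t * s + u = 1` with `u ∈ m` and `s * f = 0` follows `u * f = f`, while a power of `u`
  -- kills `f`.
  obtain ⟨t, ht⟩ := hm.exists_inv hs
  obtain ⟨u, hu, htu⟩ := ht
  obtain ⟨k, hk⟩ := kill u hu
  have h1 : u * f = f := by
    linear_combination f * htu - t * hsf
  have h2 : ∀ j : ℕ, u ^ j * f = f := by
    intro j
    induction j with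
    | zero => simp
    | succ j ih => rw [pow_succ, mul_assoc, h1, ih]
  rw [← h2 k, hk]

end OneDimensional

/-! ### The ideal of initial forms as the kernel of a linear map -/

section TangentMap

variable {d : ℕ} (n : Fin d → ℕ)

/-- The weight `∑ uᵢ nᵢ` of an exponent vector. -/
def expWeight (u : Fin d →₀ ℕ) : ℕ := ∑ i, u i * n i

/-- An exponent vector is maximal if it has the largest degree among those of its weight. -/
def IsMaximalExp (u : Fin d →₀ ℕ) : Prop :=
  ∀ v : Fin d →₀ ℕ, expWeight n v = expWeight n u → v.degree ≤ u.degree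

variable {n}

theorem expWeight_add (u v : Fin d →₀ ℕ) :
    expWeight n (u + v) = expWeight n u + expWeight n v := by
  simp [expWeight, add_mul, Finset.sum_add_distrib]

theorem expWeight_single (i : Fin d) (k : ℕ) :
    expWeight n (Finsupp.single i k) = k * n i := by
  simp only [expWeight, Finsupp.single_apply, ite_mul, zero_mul, Finset.sum_ite_eq,
    Finset.mem_univ, if_true]

theorem IsMaximalExp.of_add {u v : Fin d →₀ ℕ} (h : IsMaximalExp n (u + v)) :
    IsMaximalExp n u := fun w hw => by
  have := h (w + v) (by rw [expWeight_add, expWeight_add, hw])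
  simpa using this

theorem IsMaximalExp.degree_eq {u v : Fin d →₀ ℕ} (hu : IsMaximalExp n u)
    (hv : IsMaximalExp n v) (h : expWeight n u = expWeight n v) : u.degree = v.degree :=
  le_antisymm (hv u h) (hu v h.symm)

variable {K : Type*} [Field K]

theorem aeval_monomial_curve (u : Fin d →₀ ℕ) (c : K) :
    aeval (fun i => (Polynomial.X : Polynomial K) ^ n i) (monomial u c) =
      Polynomial.monomial (expWeight n u) c := by
  rw [aeval_monomial, Finsupp.prod_fintype _ _ (by simp)]
  simp_rw [← pow_mul]
  rw [Finset.prod_pow_eq_pow_sum, ← Polynomial.C_mul_X_pow_eq_monomial]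
  simp [expWeight, mul_comm]

theorem monomial_sub_monomial_mem_toricIdeal_iff {u v : Fin d →₀ ℕ} :
    (monomial u 1 - monomial v 1 : MvPolynomial (Fin d) K) ∈ toricIdeal K n ↔
      expWeight n u = expWeight n v := by
  rw [toricIdeal, RingHom.mem_ker, map_sub, aeval_monomial_curve, aeval_monomial_curve, sub_eq_zero]
  constructor
  · intro h
    exact (Polynomial.monomial_left_inj one_ne_zero).1 h
  · intro h; rw [h]

theorem initialForm_eq {f : MvPolynomial (Fin d) K} {k : ℕ} (hk : homogeneousComponent k f ≠ 0)
    (hlt : ∀ j < k, homogeneousComponent j f = 0) : initialForm f = homogeneousComponent k f := by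
  have : sInf {j : ℕ | homogeneousComponent j f ≠ 0} = k :=
    le_antisymm (Nat.sInf_le hk)
      (le_csInf ⟨k, hk⟩ fun j hj => not_lt.1 fun h => hj (hlt j h))
  rw [initialForm, this]

theorem initialForm_mem {I : Ideal (MvPolynomial (Fin d) K)} {f : MvPolynomial (Fin d) K}
    (hf : f ∈ I) : initialForm f ∈ initialFormIdeal I :=
  Ideal.subset_span ⟨f, hf, rfl⟩

theorem homogeneousComponent_monomial (k : ℕ) (u : Fin d →₀ ℕ) (c : K) :
    homogeneousComponent k (monomial u c) = if k = u.degree then monomial u c else 0 :=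
  homogeneousComponent_of_mem ((mem_homogeneousSubmodule _ _).2 (isHomogeneous_monomial c rfl))

theorem monomial_mem_initialFormIdeal {u : Fin d →₀ ℕ} (hu : ¬ IsMaximalExp n u) :
    (monomial u 1 : MvPolynomial (Fin d) K) ∈ initialFormIdeal (toricIdeal K n) := by
  obtain ⟨v, hv, hlt⟩ : ∃ v, expWeight n v = expWeight n u ∧ u.degree < v.degree := by
    simpa [IsMaximalExp] using hu
  have hmem : (monomial u 1 - monomial v 1 : MvPolynomial (Fin d) K) ∈ toricIdeal K n :=
    monomial_sub_monomial_mem_toricIdeal_iff.2 hv.symm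
  have h := initialForm_mem hmem
  have hcomp : ∀ j, j < v.degree →
      homogeneousComponent j (monomial u 1 - monomial v 1 : MvPolynomial (Fin d) K) =
        if j = u.degree then monomial u 1 else 0 := fun j hj => by
    rw [map_sub, homogeneousComponent_monomial, homogeneousComponent_monomial, if_neg hj.ne,
      sub_zero]
  rw [initialForm_eq (k := u.degree) (by rw [hcomp _ hlt, if_pos rfl]; simp)
    (fun j hj => by rw [hcomp _ (hj.trans hlt), if_neg hj.ne]), hcomp _ hlt, if_pos rfl] at h
  exact h

theorem monomial_sub_monomial_mem_initialFormIdeal {u v : Fin d →₀ ℕ}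
    (hw : expWeight n u = expWeight n v) (hdeg : u.degree = v.degree) :
    (monomial u 1 - monomial v 1 : MvPolynomial (Fin d) K) ∈
      initialFormIdeal (toricIdeal K n) := by
  by_cases h0 : (monomial u 1 - monomial v 1 : MvPolynomial (Fin d) K) = 0
  · rw [h0]; exact Ideal.zero_mem _
  have h := initialForm_mem (monomial_sub_monomial_mem_toricIdeal_iff (K := K).2 hw)
  have hcomp : ∀ j,
      homogeneousComponent j (monomial u 1 - monomial v 1 : MvPolynomial (Fin d) K) =
        if j = u.degree then monomial u 1 - monomial v 1 else 0 := fun j => by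
    rw [map_sub, homogeneousComponent_monomial, homogeneousComponent_monomial, ← hdeg]
    split_ifs <;> simp
  rw [initialForm_eq (k := u.degree) (by rw [hcomp, if_pos rfl]; exact h0)
    (fun j hj => by rw [hcomp, if_neg hj.ne]), hcomp, if_pos rfl] at h
  exact h

variable (K n) in
open Classical in
/-- The linear map `K[x] → K[t]` which sends a monomial of maximal degree for its weight `s` to
`t ^ s` and all other monomials to `0`. -/
noncomputable def tangentMap : MvPolynomial (Fin d) K →ₗ[K] Polynomial K :=
  (basisMonomials (Fin d) K).constr K fun u =>
    if IsMaximalExp n u then Polynomial.X ^ expWeight n u else 0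

open Classical in
theorem tangentMap_monomial (u : Fin d →₀ ℕ) (c : K) :
    tangentMap n K (monomial u c) =
      if IsMaximalExp n u then Polynomial.monomial (expWeight n u) c else 0 := by
  have h1 : tangentMap n K (monomial u 1) =
      if IsMaximalExp n u then Polynomial.X ^ expWeight n u else 0 := by
    rw [tangentMap, ← congrFun (coe_basisMonomials (Fin d) K) u, Module.Basis.constr_basis]
  have h2 : (monomial u c : MvPolynomial (Fin d) K) = c • monomial u 1 := by
    rw [smul_monomial, smul_eq_mul, mul_one]
  rw [h2, map_smul, h1]
  split_ifs
  · rw [Polynomial.smul_eq_C_mul, Polynomial.C_mul_X_pow_eq_monomial]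
  · rw [smul_zero]

theorem tangentMap_homogeneousComponent {F : MvPolynomial (Fin d) K} (hF : F ∈ toricIdeal K n)
    {e : ℕ} (he : ∀ v ∈ F.support, e ≤ v.degree) :
    tangentMap n K (homogeneousComponent e F) = 0 := by
  classical
  -- `Ψ` keeps the weights whose maximal degree is exactly `e`. As `F` has no terms below degree
  -- `e`, a term of `F` with such a weight has degree `e` and is maximal, so `Ψ` applied to the
  -- vanishing image of `F` computes the left side.
  let Ψ : Polynomial K →ₗ[K] Polynomial K := (Polynomial.basisMonomials K).constr K fun s =>
    if ∃ u, IsMaximalExp n u ∧ expWeight n u = s ∧ u.degree = e then Polynomial.X ^ s else 0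
  have hΨ : ∀ s c, Ψ (Polynomial.monomial s c) =
      if ∃ u, IsMaximalExp n u ∧ expWeight n u = s ∧ u.degree = e then
        Polynomial.monomial s c else 0 := by
    intro s c
    have h1 : Ψ (Polynomial.monomial s 1) =
        if ∃ u, IsMaximalExp n u ∧ expWeight n u = s ∧ u.degree = e then
          Polynomial.X ^ s else 0 := by
      rw [← congrFun (Polynomial.coe_basisMonomials K) s, Module.Basis.constr_basis]
    have h2 : (Polynomial.monomial s c : Polynomial K) = c • Polynomial.monomial s 1 := by
      rw [Polynomial.smul_monomial, smul_eq_mul, mul_one]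
    rw [h2, map_smul, h1]
    split_ifs
    · rw [Polynomial.X_pow_eq_monomial]
    · rw [smul_zero]
  have key : tangentMap n K (homogeneousComponent e F) =
      Ψ (aeval (fun i => (Polynomial.X : Polynomial K) ^ n i) F) := by
    conv_lhs => rw [← F.support_sum_monomial_coeff]
    conv_rhs => rw [← F.support_sum_monomial_coeff]
    simp only [map_sum]
    refine Finset.sum_congr rfl fun v hv => ?_
    rw [aeval_monomial_curve, hΨ, homogeneousComponent_monomial]
    by_cases hve : e = v.degree
    · rw [if_pos hve, tangentMap_monomial]
      refine if_congr ⟨fun h => ⟨v, h, rfl, hve.symm⟩, ?_⟩ rfl rfl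
      rintro ⟨u, hu, huw, hud⟩ w hw
      rw [← hve, ← hud]
      exact hu w (hw.trans huw.symm)
    · rw [if_neg hve, map_zero, if_neg]
      rintro ⟨u, hu, huw, hud⟩
      have h1 := he v hv
      have h2 := hu v huw.symm
      omega
  rw [key]
  rw [toricIdeal, RingHom.mem_ker] at hF
  rw [hF, map_zero]

theorem tangentMap_mul_initialForm {f : MvPolynomial (Fin d) K} (hf : f ∈ toricIdeal K n)
    (h : MvPolynomial (Fin d) K) : tangentMap n K (h * initialForm f) = 0 := by
  induction h using MvPolynomial.induction_on' with
  | add p q hp hq => rw [add_mul, map_add, hp, hq, add_zero]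
  | monomial u a =>
    set k := sInf {j : ℕ | homogeneousComponent j f ≠ 0} with hk
    have hlow : ∀ w, coeff w f ≠ 0 → k ≤ w.degree := by
      intro w hw
      refine Nat.sInf_le fun h0 => hw ?_
      have := congrArg (coeff w) h0
      simpa [coeff_homogeneousComponent] using this
    -- Multiplication by a monomial shifts degrees, so the product is again a component of lowest
    -- possible degree of an element of the toric ideal.
    have heq : monomial u a * initialForm f =
        homogeneousComponent (k + u.degree) (monomial u a * f) := by
      ext m
      rw [coeff_homogeneousComponent, coeff_monomial_mul', coeff_monomial_mul', initialForm, ← hk,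
        coeff_homogeneousComponent]
      by_cases hum : u ≤ m
      · have : m.degree = (m - u).degree + u.degree := by
          rw [← map_add, tsub_add_cancel_of_le hum]
        simp only [hum, if_true, this, add_left_inj, mul_ite, mul_zero]
      · simp [hum]
    rw [heq]
    refine tangentMap_homogeneousComponent (Ideal.mul_mem_left _ _ hf) fun v hv => ?_
    rw [mem_support_iff, coeff_monomial_mul'] at hv
    by_cases hum : u ≤ v
    · rw [if_pos hum] at hv
      have h1 := hlow _ (right_ne_zero_of_mul hv)
      have : v.degree = (v - u).degree + u.degree := by
        rw [← map_add, tsub_add_cancel_of_le hum]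
      omega
    · simp [hum] at hv

theorem tangentMap_eq_zero_of_mem {g : MvPolynomial (Fin d) K}
    (hg : g ∈ initialFormIdeal (toricIdeal K n)) : tangentMap n K g = 0 := by
  suffices h : ∀ a, tangentMap n K (a * g) = 0 by simpa using h 1
  rw [initialFormIdeal] at hg
  induction hg using Submodule.span_induction with
  | mem x hx =>
    obtain ⟨f, hf, rfl⟩ := hx
    exact tangentMap_mul_initialForm hf
  | zero => simp
  | add x y _ _ hx hy => intro a; rw [mul_add, map_add, hx, hy, add_zero]
  | smul b x _ hx => intro a; rw [smul_eq_mul, ← mul_assoc]; exact hx _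

/-- Choosing one maximal monomial per weight gives a linear map `sec` with `p ≡ sec (tangentMap p)`
modulo the ideal of initial forms. -/
theorem mem_of_tangentMap_eq_zero {g : MvPolynomial (Fin d) K}
    (hg : tangentMap n K g = 0) : g ∈ initialFormIdeal (toricIdeal K n) := by
  classical
  let sec : Polynomial K →ₗ[K] MvPolynomial (Fin d) K :=
    (Polynomial.basisMonomials K).constr K fun s =>
      if h : ∃ u, IsMaximalExp n u ∧ expWeight n u = s then monomial h.choose 1 else 0
  have hsec : ∀ u, IsMaximalExp n u → ∃ v, IsMaximalExp n v ∧ expWeight n v = expWeight n u ∧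
      sec (Polynomial.monomial (expWeight n u) 1) = monomial v 1 := by
    intro u hu
    have h : ∃ v, IsMaximalExp n v ∧ expWeight n v = expWeight n u := ⟨u, hu, rfl⟩
    refine ⟨h.choose, h.choose_spec.1, h.choose_spec.2, ?_⟩
    rw [← congrFun (Polynomial.coe_basisMonomials K) _, Module.Basis.constr_basis, dif_pos h]
  have key : ∀ p : MvPolynomial (Fin d) K,
      p - sec (tangentMap n K p) ∈ initialFormIdeal (toricIdeal K n) := by
    intro p
    induction p using MvPolynomial.induction_on' with
    | add p q hp hq =>
      rw [map_add, map_add, add_sub_add_comm]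
      exact add_mem hp hq
    | monomial u a =>
      have h2 : (monomial u a : MvPolynomial (Fin d) K) = a • monomial u 1 := by
        rw [smul_monomial, smul_eq_mul, mul_one]
      rw [h2, map_smul, map_smul, ← smul_sub, smul_eq_C_mul]
      refine Ideal.mul_mem_left _ _ ?_
      rw [tangentMap_monomial]
      split_ifs with hu
      · obtain ⟨v, hv, hw, hs⟩ := hsec u hu
        rw [hs]
        exact monomial_sub_monomial_mem_initialFormIdeal hw.symm (hu.degree_eq hv hw.symm)
      · rw [map_zero, sub_zero]
        exact monomial_mem_initialFormIdeal hu
  simpa [hg] using key g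

theorem mem_initialFormIdeal_iff {g : MvPolynomial (Fin d) K} :
    g ∈ initialFormIdeal (toricIdeal K n) ↔ tangentMap n K g = 0 :=
  ⟨tangentMap_eq_zero_of_mem, mem_of_tangentMap_eq_zero⟩

end TangentMap

/-! ### The tangent cone ring over the axis of the smallest weight -/

section TangentCone

variable {d : ℕ} {n : Fin d → ℕ} {i₀ : Fin d} {K : Type*} [Field K]

theorem mul_degree_le_expWeight (hmin : ∀ i, i ≠ i₀ → n i₀ < n i) (u : Fin d →₀ ℕ) :
    u.degree * n i₀ ≤ expWeight n u := by
  rw [Finsupp.degree_eq_sum, Finset.sum_mul]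
  refine Finset.sum_le_sum fun i _ => Nat.mul_le_mul_left _ ?_
  by_cases h : i = i₀
  · rw [h]
  · exact (hmin i h).le

theorem mul_degree_lt_expWeight (hmin : ∀ i, i ≠ i₀ → n i₀ < n i) {u : Fin d →₀ ℕ} {i : Fin d}
    (hi : i ≠ i₀) (hu : u i ≠ 0) : u.degree * n i₀ < expWeight n u := by
  rw [Finsupp.degree_eq_sum, Finset.sum_mul]
  refine Finset.sum_lt_sum (fun i _ => Nat.mul_le_mul_left _ ?_) ⟨i, Finset.mem_univ i, ?_⟩
  · by_cases h : i = i₀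
    · rw [h]
    · exact (hmin i h).le
  · exact Nat.mul_lt_mul_of_pos_left (hmin i hi) (Nat.pos_of_ne_zero hu)

variable (i₀ K) in
/-- The restriction of polynomials to the coordinate axis of the variable `x_{i₀}`. -/
noncomputable def axisMap : MvPolynomial (Fin d) K →ₐ[K] Polynomial K :=
  aeval fun i => if i = i₀ then Polynomial.X else 0

theorem axisMap_monomial_of_ne {u : Fin d →₀ ℕ} {i : Fin d} (hi : i ≠ i₀) (hu : u i ≠ 0) (c : K) :
    axisMap i₀ K (monomial u c) = 0 := by
  rw [axisMap, aeval_monomial, Finsupp.prod_fintype _ _ (by simp),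
    Finset.prod_eq_zero (Finset.mem_univ i), mul_zero]
  rw [if_neg hi, zero_pow hu]

theorem axisMap_monomial_single (k : ℕ) (c : K) :
    axisMap i₀ K (monomial (Finsupp.single i₀ k) c) = Polynomial.monomial k c := by
  rw [axisMap, aeval_monomial, Finsupp.prod_single_index (by simp), if_pos rfl,
    ← Polynomial.C_mul_X_pow_eq_monomial]
  simp

theorem isMaximalExp_single (h0 : 0 < n i₀) (hmin : ∀ i, i ≠ i₀ → n i₀ < n i) (k : ℕ) :
    IsMaximalExp n (Finsupp.single i₀ k) := fun v hv => by
  have h := mul_degree_le_expWeight hmin v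
  rw [hv, expWeight_single] at h
  rw [Finsupp.degree_single]
  exact Nat.le_of_mul_le_mul_right h h0

theorem eq_single_of_forall {u : Fin d →₀ ℕ} (h : ∀ i, i ≠ i₀ → u i = 0) :
    u = Finsupp.single i₀ (u i₀) := by
  ext i
  by_cases hi : i = i₀
  · rw [hi, Finsupp.single_eq_same]
  · rw [h i hi, Finsupp.single_eq_of_ne hi]

/-- Restriction to the axis factors through `tangentMap`: a maximal monomial involving another
variable cannot have weight `k * n i₀`, since `x_{i₀}^k` would be longer. -/
theorem axisMap_eq_zero_of_mem (h0 : 0 < n i₀) (hmin : ∀ i, i ≠ i₀ → n i₀ < n i)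
    {g : MvPolynomial (Fin d) K} (hg : g ∈ initialFormIdeal (toricIdeal K n)) :
    axisMap i₀ K g = 0 := by
  classical
  let θ : Polynomial K →ₗ[K] Polynomial K := (Polynomial.basisMonomials K).constr K fun s =>
    if n i₀ ∣ s then Polynomial.monomial (s / n i₀) 1 else 0
  have hθ : ∀ s, θ (Polynomial.monomial s 1) =
      if n i₀ ∣ s then Polynomial.monomial (s / n i₀) 1 else 0 := by
    intro s
    rw [← congrFun (Polynomial.coe_basisMonomials K) s, Module.Basis.constr_basis]
  have key : ∀ p, axisMap i₀ K p = θ (tangentMap n K p) := by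
    intro p
    induction p using MvPolynomial.induction_on' with
    | add p q hp hq => rw [map_add, map_add, map_add, hp, hq]
    | monomial u a =>
      have h2 : (monomial u a : MvPolynomial (Fin d) K) = a • monomial u 1 := by
        rw [smul_monomial, smul_eq_mul, mul_one]
      rw [h2, map_smul, map_smul, map_smul, tangentMap_monomial]
      congr 1
      by_cases hu : ∀ i, i ≠ i₀ → u i = 0
      · rw [eq_single_of_forall hu, axisMap_monomial_single,
          if_pos (isMaximalExp_single h0 hmin _), hθ, expWeight_single,
          if_pos (Dvd.intro_left _ rfl), Nat.mul_div_cancel _ h0]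
      · push Not at hu
        obtain ⟨i, hi, hui⟩ := hu
        rw [axisMap_monomial_of_ne hi hui]
        split_ifs with hmax
        · rw [hθ, if_neg]
          rintro ⟨k, hk⟩
          have h1 := hmax (Finsupp.single i₀ k) (by rw [expWeight_single, hk, mul_comm])
          have h3 := mul_degree_lt_expWeight hmin hi hui
          rw [Finsupp.degree_single] at h1
          have h4 := Nat.mul_le_mul_right (n i₀) h1
          rw [hk, mul_comm (n i₀)] at h3
          omega
        · rw [map_zero]
  rw [key, tangentMap_eq_zero_of_mem hg, map_zero]

variable (K) in
/-- The map from the tangent cone ring to `K[x_{i₀}]`, when `n i₀` is the smallest weight. -/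
noncomputable def tangentConeAxisMap (h0 : 0 < n i₀) (hmin : ∀ i, i ≠ i₀ → n i₀ < n i) :
    TangentConeRing K n →+* Polynomial K :=
  Ideal.Quotient.lift _ (axisMap i₀ K).toRingHom fun _ hg => axisMap_eq_zero_of_mem h0 hmin hg

variable (n i₀ K) in
/-- The map `K[x_{i₀}] → K[x] / I_*`. -/
noncomputable def tangentConeSection : Polynomial K →+* TangentConeRing K n :=
  (Ideal.Quotient.mk _).comp
    (Polynomial.aeval (X i₀ : MvPolynomial (Fin d) K)).toRingHom

theorem tangentConeAxisMap_section (h0 : 0 < n i₀) (hmin : ∀ i, i ≠ i₀ → n i₀ < n i)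
    (p : Polynomial K) :
    tangentConeAxisMap K h0 hmin (tangentConeSection n i₀ K p) = p := by
  have : (axisMap i₀ K).comp (Polynomial.aeval (X i₀ : MvPolynomial (Fin d) K)) =
      AlgHom.id K _ := by
    apply Polynomial.algHom_ext
    simp [axisMap]
  exact DFunLike.congr_fun this p

theorem isNilpotent_of_tangentConeAxisMap_eq_zero (h0 : 0 < n i₀)
    (hmin : ∀ i, i ≠ i₀ → n i₀ < n i) (r : TangentConeRing K n)
    (hr : tangentConeAxisMap K h0 hmin r = 0) : IsNilpotent r := by
  obtain ⟨g, rfl⟩ := Ideal.Quotient.mk_surjective r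
  have hX : ∀ i, i ≠ i₀ → IsNilpotent
      (Ideal.Quotient.mk (initialFormIdeal (toricIdeal K n)) (X i)) := by
    intro i hi
    -- `x_i ^ n i₀` has the same weight as the longer monomial `x_{i₀} ^ n i`.
    refine ⟨n i₀, ?_⟩
    rw [← map_pow, Ideal.Quotient.eq_zero_iff_mem, X_pow_eq_monomial]
    refine monomial_mem_initialFormIdeal fun hmax => ?_
    have := hmax (Finsupp.single i₀ (n i)) (by rw [expWeight_single, expWeight_single, mul_comm])
    rw [Finsupp.degree_single, Finsupp.degree_single] at this
    exact absurd (hmin i hi) (not_lt.2 this)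
  have key : ∀ p : MvPolynomial (Fin d) K, IsNilpotent
      (Ideal.Quotient.mk (initialFormIdeal (toricIdeal K n))
        (p - Polynomial.aeval (X i₀) (axisMap i₀ K p))) := by
    intro p
    rw [← mem_nilradical]
    have h : (Ideal.Quotient.mkₐ K (nilradical (TangentConeRing K n))).comp
          (Ideal.Quotient.mkₐ K (initialFormIdeal (toricIdeal K n))) =
        ((Ideal.Quotient.mkₐ K (nilradical (TangentConeRing K n))).comp
          (Ideal.Quotient.mkₐ K (initialFormIdeal (toricIdeal K n)))).comp
            ((Polynomial.aeval (X i₀)).comp (axisMap i₀ K)) := by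
      apply MvPolynomial.algHom_ext
      intro i
      by_cases hi : i = i₀
      · simp [axisMap, hi]
      · simp only [AlgHom.comp_apply, axisMap, aeval_X, if_neg hi, map_zero]
        exact Ideal.Quotient.eq_zero_iff_mem.2 (hX i hi)
    have h' := DFunLike.congr_fun h p
    rw [map_sub]
    exact Ideal.Quotient.eq.1 h'
  have hr' : axisMap i₀ K g = 0 := hr
  simpa [hr'] using key g

open Classical in
theorem tangentMap_X_mul (hmul : ∀ u, IsMaximalExp n u → IsMaximalExp n (u + Finsupp.single i₀ 1))
    (g : MvPolynomial (Fin d) K) :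
    tangentMap n K (X i₀ * g) = Polynomial.X ^ n i₀ * tangentMap n K g := by
  induction g using MvPolynomial.induction_on' with
  | add p q hp hq => rw [mul_add, map_add, map_add, hp, hq, mul_add]
  | monomial u a =>
    rw [X, monomial_mul, tangentMap_monomial, tangentMap_monomial, one_mul, add_comm]
    by_cases hu : IsMaximalExp n u
    · rw [if_pos hu, if_pos (hmul u hu), expWeight_add, expWeight_single, one_mul,
        Polynomial.X_pow_mul_monomial]
    · rw [if_neg hu, if_neg fun h => hu h.of_add, mul_zero]

theorem tangentMap_aeval_mul
    (hmul : ∀ u, IsMaximalExp n u → IsMaximalExp n (u + Finsupp.single i₀ 1))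
    (p : Polynomial K) (g : MvPolynomial (Fin d) K) :
    tangentMap n K (Polynomial.aeval (X i₀) p * g) =
      Polynomial.expand K (n i₀) p * tangentMap n K g := by
  induction p using Polynomial.induction_on' with
  | add p q hp hq => rw [map_add, add_mul, map_add, hp, hq, map_add, add_mul]
  | monomial k a =>
    induction k with
    | zero =>
      simp [← MvPolynomial.smul_eq_C_mul, ← Polynomial.smul_eq_C_mul]
    | succ k ih =>
      have h1 : (Polynomial.monomial (k + 1) a : Polynomial K) =
          Polynomial.X * Polynomial.monomial k a := by
        rw [Polynomial.X_mul_monomial]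
      rw [h1, map_mul (Polynomial.aeval (X i₀)), map_mul (Polynomial.expand K (n i₀)),
        Polynomial.aeval_X, Polynomial.expand_X, mul_assoc,
        tangentMap_X_mul hmul, ih, mul_assoc]

/-- If maximality is preserved, `tangentMap` turns multiplication by `p(x_{i₀})` into multiplication
by `p(t ^ n i₀)` in a domain. Otherwise some nonzero class of a maximal monomial is killed by
`x_{i₀}`. -/
theorem hasCohenMacaulayTangentCone_iff (hpos : ∀ i, 0 < n i)
    (hmin : ∀ i, i ≠ i₀ → n i₀ < n i) :
    HasCohenMacaulayTangentCone K n ↔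
      ∀ u, IsMaximalExp n u → IsMaximalExp n (u + Finsupp.single i₀ 1) := by
  classical
  have hσ := tangentConeAxisMap_section (K := K) (hpos i₀) hmin
  have hnil := isNilpotent_of_tangentConeAxisMap_eq_zero (K := K) (hpos i₀) hmin
  constructor
  · intro hCM u hu
    by_contra hcon
    have h1 := monomial_mem_initialFormIdeal (K := K) hcon
    have h2 := regular_of_isCohenMacaulayRing _ hCM hnil _ hσ
      (Ideal.Quotient.mk _ (monomial u 1)) (by
        have : tangentConeSection n i₀ K Polynomial.X = Ideal.Quotient.mk _ (X i₀) := by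
          simp [tangentConeSection]
        rw [this, ← map_mul, Ideal.Quotient.eq_zero_iff_mem, X, monomial_mul, one_mul, add_comm]
        exact h1)
    rw [Ideal.Quotient.eq_zero_iff_mem, mem_initialFormIdeal_iff, tangentMap_monomial,
      if_pos hu] at h2
    simp at h2
  · intro hmul
    refine isCohenMacaulayRing_of_section _ hnil _ hσ fun p hp r hr => ?_
    obtain ⟨g, rfl⟩ := Ideal.Quotient.mk_surjective r
    have h1 : Polynomial.aeval (X i₀) p * g ∈ initialFormIdeal (toricIdeal K n) := by
      rw [← Ideal.Quotient.eq_zero_iff_mem, map_mul]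
      exact hr
    rw [Ideal.Quotient.eq_zero_iff_mem, mem_initialFormIdeal_iff]
    rw [mem_initialFormIdeal_iff, tangentMap_aeval_mul hmul] at h1
    refine (mul_eq_zero.1 h1).resolve_left fun h => hp ?_
    exact (Polynomial.expand_eq_zero (hpos i₀)).1 h

end TangentCone

/-! ### Connectedness of monomials modulo a binomial ideal -/

section BinomialIdeal

/-- The linear functional taking the value 1 on monomials in `A` and 0 on the others vanishes on the
ideal. -/
theorem mem_iff_mem_of_binomial_mem_span {σ K : Type*} [Field K]
    {B : Set (MvPolynomial σ K)} {A : Set (σ →₀ ℕ)}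
    (hA : ∀ b ∈ B, ∃ p q : σ →₀ ℕ, b = monomial p 1 - monomial q 1 ∧
      ∀ m, m + p ∈ A ↔ m + q ∈ A)
    {u v : σ →₀ ℕ} (huv : (monomial u 1 - monomial v 1 : MvPolynomial σ K) ∈ Ideal.span B) :
    u ∈ A ↔ v ∈ A := by
  classical
  let χ : MvPolynomial σ K →ₗ[K] K :=
    (basisMonomials σ K).constr K fun w => if w ∈ A then 1 else 0
  have hχ : ∀ w, χ (monomial w 1) = if w ∈ A then 1 else 0 := fun w => by
    rw [← congrFun (coe_basisMonomials σ K) w, Module.Basis.constr_basis]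
  have key : ∀ g ∈ Ideal.span B, ∀ h, χ (h * g) = 0 := by
    intro g hg
    induction hg using Submodule.span_induction with
    | mem b hb =>
      intro h
      obtain ⟨p, q, rfl, hpq⟩ := hA b hb
      induction h using MvPolynomial.induction_on' with
      | add f g hf hg => rw [add_mul, map_add, hf, hg, add_zero]
      | monomial m a =>
        have h2 : (monomial m a : MvPolynomial σ K) = a • monomial m 1 := by
          rw [smul_monomial, smul_eq_mul, mul_one]
        rw [h2, smul_mul_assoc, map_smul, mul_sub, monomial_mul, monomial_mul, one_mul, map_sub,
          hχ, hχ, if_congr (hpq m) rfl rfl, sub_self, smul_zero]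
    | zero => simp
    | add x y _ _ hx hy => intro a; rw [mul_add, map_add, hx, hy, add_zero]
    | smul b x _ hx => intro a; rw [smul_eq_mul, ← mul_assoc]; exact hx _
  have h := key _ huv 1
  rw [one_mul, map_sub, hχ, hχ, sub_eq_zero] at h
  by_cases hu : u ∈ A <;> by_cases hv : v ∈ A <;> simp_all

end BinomialIdeal

/-! ### Combinatorics of factorizations under the five exchanges -/

section FourGenerators

/-- A property of exponent vectors in four variables is closed under the binomials `f₁, …, f₅` if
exchanging the two terms of a binomial does not change it. -/
structure IsClosedUnderMoves (a₁ a₂ a₃ a₄ a₁₂ a₁₄ a₂₁ a₂₃ a₃₁ a₃₄ a₄₂ a₄₃ : ℕ)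
    (P : ℕ → ℕ → ℕ → ℕ → Prop) : Prop where
  f₁ : ∀ i j k l, P (i + a₁) j k l ↔ P i (j + a₁₂) k (l + a₁₄)
  f₂ : ∀ i j k l, P i (j + a₂) k l ↔ P (i + a₂₁) j (k + a₂₃) l
  f₃ : ∀ i j k l, P i j (k + a₃) l ↔ P (i + a₃₁) j k (l + a₃₄)
  f₄ : ∀ i j k l, P i j k (l + a₄) ↔ P i (j + a₄₂) (k + a₄₃) l
  f₅ : ∀ i j k l, P (i + a₃₁) (j + a₄₂) k l ↔ P i j (k + a₂₃) (l + a₁₄)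

variable {n₁ n₂ n₃ n₄ a₁ a₂ a₃ a₄ a₁₂ a₁₄ a₂₁ a₂₃ a₃₁ a₃₄ a₄₂ a₄₃ : ℕ}

/-- Among the factorizations of `i n₁ + j n₂ + k n₃ + l n₄`, the given one has maximal length. -/
def IsLongest (n₁ n₂ n₃ n₄ i j k l : ℕ) : Prop :=
  ∀ i' j' k' l', i' * n₁ + j' * n₂ + k' * n₃ + l' * n₄ = i * n₁ + j * n₂ + k * n₃ + l * n₄ →
    i' + j' + k' + l' ≤ i + j + k + l

/-- The exponent bounds prevent every exchange on `x₂^b`, so it is alone in its class. Here `hconn`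
expresses that the exchanges connect all factorizations of equal weight. -/
theorem pow_second_unique (h₁₄ : 0 < a₁₄ ∧ a₁₄ < a₄)
    (h₂₁ : 0 < a₂₁ ∧ a₂₁ < a₁) (h₂₃ : 0 < a₂₃ ∧ a₂₃ < a₃)
    (h₃₁ : 0 < a₃₁ ∧ a₃₁ < a₁) (h₃₄ : 0 < a₃₄ ∧ a₃₄ < a₄)
    (h₄₃ : 0 < a₄₃ ∧ a₄₃ < a₃)
    (hconn : ∀ P, IsClosedUnderMoves a₁ a₂ a₃ a₄ a₁₂ a₁₄ a₂₁ a₂₃ a₃₁ a₃₄ a₄₂ a₄₃ P →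
      ∀ i j k l i' j' k' l',
        i * n₁ + j * n₂ + k * n₃ + l * n₄ = i' * n₁ + j' * n₂ + k' * n₃ + l' * n₄ →
        P i j k l → P i' j' k' l')
    (b : ℕ) (hb : b < a₂) (i j k l : ℕ) (h : b * n₂ = i * n₁ + j * n₂ + k * n₃ + l * n₄) :
    i = 0 ∧ j = b ∧ k = 0 ∧ l = 0 :=
  hconn (fun i j k l => i = 0 ∧ j = b ∧ k = 0 ∧ l = 0)
    (by constructor <;> intros <;> omega) 0 b 0 0 i j k l (by simpa using h) (by simp)

theorem pow_third_unique (h₁₂ : 0 < a₁₂ ∧ a₁₂ < a₂) (h₁₄ : 0 < a₁₄ ∧ a₁₄ < a₄)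
    (h₂₁ : 0 < a₂₁ ∧ a₂₁ < a₁) (h₃₄ : 0 < a₃₄ ∧ a₃₄ < a₄)
    (h₄₂ : 0 < a₄₂ ∧ a₄₂ < a₂)
    (hconn : ∀ P, IsClosedUnderMoves a₁ a₂ a₃ a₄ a₁₂ a₁₄ a₂₁ a₂₃ a₃₁ a₃₄ a₄₂ a₄₃ P →
      ∀ i j k l i' j' k' l',
        i * n₁ + j * n₂ + k * n₃ + l * n₄ = i' * n₁ + j' * n₂ + k' * n₃ + l' * n₄ →
        P i j k l → P i' j' k' l')
    (b : ℕ) (hb : b < a₃) (i j k l : ℕ) (h : b * n₃ = i * n₁ + j * n₂ + k * n₃ + l * n₄) :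
    i = 0 ∧ j = 0 ∧ k = b ∧ l = 0 :=
  hconn (fun i j k l => i = 0 ∧ j = 0 ∧ k = b ∧ l = 0)
    (by constructor <;> intros <;> omega) 0 0 b 0 i j k l (by simpa using h) (by simp)

theorem pow_fourth_unique (h₁₂ : 0 < a₁₂ ∧ a₁₂ < a₂)
    (h₂₁ : 0 < a₂₁ ∧ a₂₁ < a₁) (h₂₃ : 0 < a₂₃ ∧ a₂₃ < a₃)
    (h₃₁ : 0 < a₃₁ ∧ a₃₁ < a₁) (h₄₂ : 0 < a₄₂ ∧ a₄₂ < a₂) (h₄₃ : 0 < a₄₃ ∧ a₄₃ < a₃)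
    (hconn : ∀ P, IsClosedUnderMoves a₁ a₂ a₃ a₄ a₁₂ a₁₄ a₂₁ a₂₃ a₃₁ a₃₄ a₄₂ a₄₃ P →
      ∀ i j k l i' j' k' l',
        i * n₁ + j * n₂ + k * n₃ + l * n₄ = i' * n₁ + j' * n₂ + k' * n₃ + l' * n₄ →
        P i j k l → P i' j' k' l')
    (b : ℕ) (hb : b < a₄) (i j k l : ℕ) (h : b * n₄ = i * n₁ + j * n₂ + k * n₃ + l * n₄) :
    i = 0 ∧ j = 0 ∧ k = 0 ∧ l = b :=
  hconn (fun i j k l => i = 0 ∧ j = 0 ∧ k = 0 ∧ l = b)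
    (by constructor <;> intros <;> omega) 0 0 0 b i j k l (by simpa using h) (by simp)

theorem exponent_relations (hn₁ : 0 < n₁) (hn₃ : 0 < n₃)
    (h₁₂ : 0 < a₁₂ ∧ a₁₂ < a₂) (h₁₄ : 0 < a₁₄ ∧ a₁₄ < a₄)
    (h₂₁ : 0 < a₂₁ ∧ a₂₁ < a₁) (h₂₃ : 0 < a₂₃ ∧ a₂₃ < a₃)
    (h₃₁ : 0 < a₃₁ ∧ a₃₁ < a₁) (h₃₄ : 0 < a₃₄ ∧ a₃₄ < a₄)
    (h₄₂ : 0 < a₄₂ ∧ a₄₂ < a₂) (h₄₃ : 0 < a₄₃ ∧ a₄₃ < a₃)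
    (w₁ : a₁ * n₁ = a₁₂ * n₂ + a₁₄ * n₄) (w₂ : a₂ * n₂ = a₂₁ * n₁ + a₂₃ * n₃)
    (w₃ : a₃ * n₃ = a₃₁ * n₁ + a₃₄ * n₄) (w₄ : a₄ * n₄ = a₄₂ * n₂ + a₄₃ * n₃)
    (w₅ : a₃₁ * n₁ + a₄₂ * n₂ = a₂₃ * n₃ + a₁₄ * n₄)
    (hconn : ∀ P, IsClosedUnderMoves a₁ a₂ a₃ a₄ a₁₂ a₁₄ a₂₁ a₂₃ a₃₁ a₃₄ a₄₂ a₄₃ P →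
      ∀ i j k l i' j' k' l',
        i * n₁ + j * n₂ + k * n₃ + l * n₄ = i' * n₁ + j' * n₂ + k' * n₃ + l' * n₄ →
        P i j k l → P i' j' k' l') :
    (a₁ = a₂₁ + a₃₁ ∧ a₂ = a₁₂ + a₄₂) ∧ a₃ = a₂₃ + a₄₃ ∧ a₄ = a₁₄ + a₃₄ := by
  have uniq₂ := pow_second_unique h₁₄ h₂₁ h₂₃ h₃₁ h₃₄ h₄₃ hconn
  have uniq₄ := pow_fourth_unique h₁₂ h₂₁ h₂₃ h₃₁ h₄₂ h₄₃ hconn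
  have rel₁₂ : a₁ = a₂₁ + a₃₁ ∧ a₂ = a₁₂ + a₄₂ := by
    -- Here `c + 1` is `a₁ - a₃₁`. Eliminating `a₁₄ * n₄` from `w₁` and `w₅`, then subtracting `w₂`,
    -- leaves `e * n₂ = g * n₁` with `e < a₂`, so uniqueness gives `e = g = 0`.
    obtain ⟨c, rfl⟩ := Nat.exists_eq_add_of_lt h₃₁.2
    have e₁ : (a₁₂ + a₄₂) * n₂ = (c + 1) * n₁ + a₂₃ * n₃ := by linarith
    have hge : a₂ ≤ a₁₂ + a₄₂ := by
      by_contra hlt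
      have := uniq₂ (a₁₂ + a₄₂) (by omega) (c + 1) 0 a₂₃ 0 (by linarith)
      omega
    obtain ⟨e, he⟩ := Nat.exists_eq_add_of_le hge
    rw [he] at e₁
    have e₂ : e * n₂ + a₂₁ * n₁ = (c + 1) * n₁ := by linarith
    have hc : a₂₁ ≤ c + 1 := Nat.le_of_mul_le_mul_right (by linarith [Nat.zero_le (e * n₂)]) hn₁
    obtain ⟨g, hg⟩ := Nat.exists_eq_add_of_le hc
    rw [hg] at e₂
    have := uniq₂ e (by omega) g 0 0 0 (by linarith)
    omega
  have rel₃₄ : a₃ = a₂₃ + a₄₃ ∧ a₄ = a₁₄ + a₃₄ := by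
    obtain ⟨c, rfl⟩ := Nat.exists_eq_add_of_lt h₂₃.2
    have e₁ : (a₁₄ + a₃₄) * n₄ = a₄₂ * n₂ + (c + 1) * n₃ := by linarith
    have hge : a₄ ≤ a₁₄ + a₃₄ := by
      by_contra hlt
      have := uniq₄ (a₁₄ + a₃₄) (by omega) 0 a₄₂ (c + 1) 0 (by linarith)
      omega
    obtain ⟨e, he⟩ := Nat.exists_eq_add_of_le hge
    rw [he] at e₁
    have e₂ : e * n₄ + a₄₃ * n₃ = (c + 1) * n₃ := by linarith
    have hc : a₄₃ ≤ c + 1 :=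
      Nat.le_of_mul_le_mul_right (by linarith [Nat.zero_le (e * n₄)]) hn₃
    obtain ⟨g, hg⟩ := Nat.exists_eq_add_of_le hc
    rw [hg] at e₂
    have := uniq₄ e (by omega) 0 0 g 0 (by linarith)
    omega
  exact ⟨rel₁₂, rel₃₄⟩

theorem exists_normal_factorization (hn₁ : 0 < n₁) (hn₂ : 0 < n₂) (hn₃ : 0 < n₃) (hn₄ : 0 < n₄)
    (h₂₁ : 0 < a₂₁) (h₃₁ : 0 < a₃₁)
    (w₁ : a₁ * n₁ = a₁₂ * n₂ + a₁₄ * n₄) (w₂ : a₂ * n₂ = a₂₁ * n₁ + a₂₃ * n₃)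
    (w₃ : a₃ * n₃ = a₃₁ * n₁ + a₃₄ * n₄) (w₄ : a₄ * n₄ = a₄₂ * n₂ + a₄₃ * n₃)
    (w₅ : a₃₁ * n₁ + a₄₂ * n₂ = a₂₃ * n₃ + a₁₄ * n₄)
    (hlt₁ : a₁₂ + a₁₄ < a₁) (hle₂ : a₂ ≤ a₂₁ + a₂₃) (hle₃ : a₃ ≤ a₃₁ + a₃₄)
    (hlt₄ : a₄ < a₄₂ + a₄₃) (hlt₅ : a₂₃ + a₁₄ < a₃₁ + a₄₂) (i j k l : ℕ) :
    ∃ i' j' k' l',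
      i' * n₁ + j' * n₂ + k' * n₃ + l' * n₄ = i * n₁ + j * n₂ + k * n₃ + l * n₄ ∧
      i + j + k + l ≤ i' + j' + k' + l' ∧ j' < a₂ ∧ k' < a₃ ∧ l' < a₄ ∧
      ¬ (a₁₂ ≤ j' ∧ a₁₄ ≤ l') ∧ ¬ (a₂₃ ≤ k' ∧ a₁₄ ≤ l') := by
  -- The count `2 * i + j + k + l` is at most twice the weight. Counting `x₁` doubly makes it grow
  -- even when the exchanges `f₂`, `f₃` preserve length.
  induction hm : 2 * (i * n₁ + j * n₂ + k * n₃ + l * n₄) - (2 * i + j + k + l) using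
    Nat.strong_induction_on generalizing i j k l with
  | _ m ih =>
    have step : ∀ x y z t, x * n₁ + y * n₂ + z * n₃ + t * n₄ =
        i * n₁ + j * n₂ + k * n₃ + l * n₄ → i + j + k + l ≤ x + y + z + t →
        2 * i + j + k + l < 2 * x + y + z + t → ∃ i' j' k' l',
        i' * n₁ + j' * n₂ + k' * n₃ + l' * n₄ = i * n₁ + j * n₂ + k * n₃ + l * n₄ ∧
        i + j + k + l ≤ i' + j' + k' + l' ∧ j' < a₂ ∧ k' < a₃ ∧ l' < a₄ ∧
        ¬ (a₁₂ ≤ j' ∧ a₁₄ ≤ l') ∧ ¬ (a₂₃ ≤ k' ∧ a₁₄ ≤ l') := by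
      intro x y z t hw hd hlt
      have b₁ := Nat.le_mul_of_pos_right x hn₁
      have b₂ := Nat.le_mul_of_pos_right y hn₂
      have b₃ := Nat.le_mul_of_pos_right z hn₃
      have b₄ := Nat.le_mul_of_pos_right t hn₄
      obtain ⟨i', j', k', l', hw', hd', hnorm⟩ := ih _ (by omega) x y z t rfl
      exact ⟨i', j', k', l', hw'.trans hw, hd.trans hd', hnorm⟩
    by_cases c₁ : a₁₂ ≤ j ∧ a₁₄ ≤ l
    · obtain ⟨⟨y, rfl⟩, ⟨t, rfl⟩⟩ := c₁.imp Nat.exists_eq_add_of_le Nat.exists_eq_add_of_le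
      exact step (i + a₁) y k t (by linarith) (by omega) (by omega)
    by_cases c₂ : a₂ ≤ j
    · obtain ⟨y, rfl⟩ := Nat.exists_eq_add_of_le c₂
      exact step (i + a₂₁) y (k + a₂₃) l (by linarith) (by omega) (by omega)
    by_cases c₃ : a₃ ≤ k
    · obtain ⟨z, rfl⟩ := Nat.exists_eq_add_of_le c₃
      exact step (i + a₃₁) j z (l + a₃₄) (by linarith) (by omega) (by omega)
    by_cases c₄ : a₄ ≤ l
    · obtain ⟨t, rfl⟩ := Nat.exists_eq_add_of_le c₄
      exact step i (j + a₄₂) (k + a₄₃) t (by linarith) (by omega) (by omega)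
    by_cases c₅ : a₂₃ ≤ k ∧ a₁₄ ≤ l
    · obtain ⟨⟨z, rfl⟩, ⟨t, rfl⟩⟩ := c₅.imp Nat.exists_eq_add_of_le Nat.exists_eq_add_of_le
      exact step (i + a₃₁) (j + a₄₂) z t (by linarith) (by omega) (by omega)
    exact ⟨i, j, k, l, rfl, le_rfl, by omega, by omega, by omega, c₁, c₅⟩

/-- From a normal form without `x₁`, only `x₂^a₄₂ x₃^a₄₃ → x₄^a₄` and its reverse ever apply: after
one such step the exponents of `x₂` and `x₃` are below `a₁₂` and `a₂₃`, which blocks `f₁` and `f₅`.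
-/
theorem isClosedUnderMoves_orbit {q r s : ℕ}
    (h₂₁ : 0 < a₂₁ ∧ a₂₁ < a₁) (h₃₁ : 0 < a₃₁ ∧ a₃₁ < a₁)
    (ha₂ : a₂ = a₁₂ + a₄₂) (ha₃ : a₃ = a₂₃ + a₄₃)
    (hq : q < a₂) (hr : r < a₃) (hs : s < a₄) (hqs : ¬ (a₁₂ ≤ q ∧ a₁₄ ≤ s))
    (hrs : ¬ (a₂₃ ≤ r ∧ a₁₄ ≤ s)) :
    IsClosedUnderMoves a₁ a₂ a₃ a₄ a₁₂ a₁₄ a₂₁ a₂₃ a₃₁ a₃₄ a₄₂ a₄₃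
      fun x y z t => ∃ c, x = 0 ∧ y + c * a₄₂ = q ∧ z + c * a₄₃ = r ∧ t = s + c * a₄ := by
  constructor <;> intro x y z t <;> constructor <;> rintro ⟨c, hx, hy, hz, ht⟩
  · omega
  · obtain _ | c := c
    · omega
    · rw [add_mul] at hy; omega
  · have := Nat.zero_le (c * a₄₂); omega
  · omega
  · have := Nat.zero_le (c * a₄₃); omega
  · omega
  · obtain _ | c := c
    · omega
    · rw [add_mul] at hy hz ht
      exact ⟨c, hx, by omega, by omega, by omega⟩
  · exact ⟨c + 1, hx, by rw [add_mul]; omega, by rw [add_mul]; omega, by rw [add_mul]; omega⟩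
  · omega
  · obtain _ | c := c
    · omega
    · rw [add_mul] at hz; omega

theorem isLongest_add_iff (hn₁ : 0 < n₁) (hn₁₂ : n₁ < n₂) (hn₂₃ : n₂ < n₃) (hn₃₄ : n₃ < n₄)
    (h₁₂ : 0 < a₁₂ ∧ a₁₂ < a₂) (h₁₄ : 0 < a₁₄ ∧ a₁₄ < a₄)
    (h₂₁ : 0 < a₂₁ ∧ a₂₁ < a₁) (h₂₃ : 0 < a₂₃ ∧ a₂₃ < a₃)
    (h₃₁ : 0 < a₃₁ ∧ a₃₁ < a₁) (h₃₄ : 0 < a₃₄ ∧ a₃₄ < a₄)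
    (h₄₂ : 0 < a₄₂ ∧ a₄₂ < a₂) (h₄₃ : 0 < a₄₃ ∧ a₄₃ < a₃)
    (w₁ : a₁ * n₁ = a₁₂ * n₂ + a₁₄ * n₄) (w₂ : a₂ * n₂ = a₂₁ * n₁ + a₂₃ * n₃)
    (w₃ : a₃ * n₃ = a₃₁ * n₁ + a₃₄ * n₄) (w₄ : a₄ * n₄ = a₄₂ * n₂ + a₄₃ * n₃)
    (w₅ : a₃₁ * n₁ + a₄₂ * n₂ = a₂₃ * n₃ + a₁₄ * n₄)
    (hconn : ∀ P, IsClosedUnderMoves a₁ a₂ a₃ a₄ a₁₂ a₁₄ a₂₁ a₂₃ a₃₁ a₃₄ a₄₂ a₄₃ P →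
      ∀ i j k l i' j' k' l',
        i * n₁ + j * n₂ + k * n₃ + l * n₄ = i' * n₁ + j' * n₂ + k' * n₃ + l' * n₄ →
        P i j k l → P i' j' k' l') :
    (∀ i j k l, IsLongest n₁ n₂ n₃ n₄ i j k l → IsLongest n₁ n₂ n₃ n₄ (i + 1) j k l) ↔
      a₂ ≤ a₂₁ + a₂₃ ∧ a₃ ≤ a₃₁ + a₃₄ := by
  have uniq₃ := pow_third_unique h₁₂ h₁₄ h₂₁ h₃₄ h₄₂ hconn
  have uniq₄ := pow_fourth_unique h₁₂ h₂₁ h₂₃ h₃₁ h₄₂ h₄₃ hconn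
  constructor
  · intro hadd
    have hadd' : ∀ c i j k l, IsLongest n₁ n₂ n₃ n₄ i j k l →
        IsLongest n₁ n₂ n₃ n₄ (i + c) j k l := by
      intro c
      induction c with
      | zero => exact fun _ _ _ _ h => h
      | succ c ih => exact fun i j k l h => hadd _ _ _ _ (ih _ _ _ _ h)
    constructor
    -- Being the only factorization of its weight, `x₃^a₂₃` is longest; its multiple by `x₁^a₂₁` is
    -- then compared with `x₂^a₂`.
    · have h : IsLongest n₁ n₂ n₃ n₄ 0 0 a₂₃ 0 := fun i j k l h => by
        have := uniq₃ a₂₃ h₂₃.2 i j k l (by linarith)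
        omega
      have := hadd' a₂₁ _ _ _ _ h 0 a₂ 0 0 (by linarith)
      omega
    · have h : IsLongest n₁ n₂ n₃ n₄ 0 0 0 a₃₄ := fun i j k l h => by
        have := uniq₄ a₃₄ h₃₄.2 i j k l (by linarith)
        omega
      have := hadd' a₃₁ _ _ _ _ h 0 0 a₃ 0 (by linarith)
      omega
  rintro ⟨hle₂, hle₃⟩
  obtain ⟨⟨ha₁, ha₂⟩, ha₃, ha₄⟩ := exponent_relations hn₁ (hn₁.trans (hn₁₂.trans hn₂₃))
    h₁₂ h₁₄ h₂₁ h₂₃ h₃₁ h₃₄ h₄₂ h₄₃ w₁ w₂ w₃ w₄ w₅ hconn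
  have hlt₁ : a₁₂ + a₁₄ < a₁ := by
    refine Nat.lt_of_mul_lt_mul_right (a := n₁) ?_
    have := Nat.mul_lt_mul_of_pos_left hn₁₂ h₁₂.1
    have := Nat.mul_lt_mul_of_pos_left (by omega : n₁ < n₄) h₁₄.1
    linarith
  have hlt₄ : a₄ < a₄₂ + a₄₃ := by
    refine Nat.lt_of_mul_lt_mul_right (a := n₄) ?_
    have := Nat.mul_lt_mul_of_pos_left (by omega : n₂ < n₄) h₄₂.1
    have := Nat.mul_lt_mul_of_pos_left hn₃₄ h₄₃.1
    linarith
  intro i j k l hlong i' j' k' l' hw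
  -- The bound `a₂₃ + a₁₄ < a₃₁ + a₄₂` is the sum of `hlt₄` and `hle₃` after cancellation by `ha₃`
  -- and `ha₄`.
  obtain ⟨p, q, r, s, hw', hd, hq, hr, hs, hqs, hrs⟩ :=
    exists_normal_factorization hn₁ (by omega) (by omega) (by omega) h₂₁.1 h₃₁.1 w₁ w₂ w₃ w₄ w₅
      hlt₁ hle₂ hle₃ hlt₄ (by omega) i' j' k' l'
  obtain rfl | hp := Nat.eq_zero_or_pos p
  -- Without `x₁` in the normal form, no factorization of this weight contains `x₁`, but the one
  -- with first exponent `i + 1` does.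
  · exfalso
    have hclosed := isClosedUnderMoves_orbit (a₃₄ := a₃₄) h₂₁ h₃₁ ha₂ ha₃
      hq hr hs hqs hrs
    obtain ⟨c, hx, -⟩ := hconn _ hclosed 0 q r s (i + 1) j k l (hw'.trans hw) ⟨0, by simp⟩
    omega
  · obtain ⟨p, rfl⟩ := Nat.exists_eq_add_of_lt hp
    have := hlong p q r s (by linarith)
    omega

/-- The exponent vector of `x₁ ^ i * x₂ ^ j * x₃ ^ k * x₄ ^ l`. -/
noncomputable def expVec (i j k l : ℕ) : Fin 4 →₀ ℕ := Finsupp.equivFunOnFinite.symm ![i, j, k, l]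

theorem expVec_add (i j k l i' j' k' l' : ℕ) :
    expVec i j k l + expVec i' j' k' l' = expVec (i + i') (j + j') (k + k') (l + l') := by
  ext x
  fin_cases x <;> rfl

theorem eq_expVec (u : Fin 4 →₀ ℕ) : u = expVec (u 0) (u 1) (u 2) (u 3) := by
  ext x
  fin_cases x <;> rfl

theorem degree_expVec (i j k l : ℕ) : (expVec i j k l).degree = i + j + k + l := by
  rw [Finsupp.degree_eq_sum, Fin.sum_univ_four]; rfl

theorem expWeight_expVec (n : Fin 4 → ℕ) (i j k l : ℕ) :
    expWeight n (expVec i j k l) = i * n 0 + j * n 1 + k * n 2 + l * n 3 := by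
  rw [expWeight, Fin.sum_univ_four]; rfl

theorem monomial_expVec {K : Type*} [Field K] (i j k l : ℕ) :
    (monomial (expVec i j k l) 1 : MvPolynomial (Fin 4) K) =
      X 0 ^ i * X 1 ^ j * X 2 ^ k * X 3 ^ l := by
  rw [monomial_eq, Finsupp.prod_fintype _ _ (by simp), Fin.prod_univ_four, C_1, one_mul]; rfl

theorem isMaximalExp_expVec_iff (n : Fin 4 → ℕ) (i j k l : ℕ) :
    IsMaximalExp n (expVec i j k l) ↔ IsLongest (n 0) (n 1) (n 2) (n 3) i j k l := by
  constructor
  · intro h i' j' k' l' hw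
    simpa only [degree_expVec] using
      h (expVec i' j' k' l') (by rw [expWeight_expVec, expWeight_expVec, hw])
  · intro h v hv
    rw [eq_expVec v, expWeight_expVec, expWeight_expVec] at hv
    rw [eq_expVec v, degree_expVec, degree_expVec]
    exact h _ _ _ _ hv

end FourGenerators

end MonomialCurve

/-! ### The Cohen–Macaulay criterion -/

open MonomialCurve in
theorem mainTheorem7 {K : Type*} [Field K] (n : Fin 4 → ℕ)
    (hpos : ∀ i, 0 < n i) (hmono : StrictMono n) (hgcd : Finset.univ.gcd n = 1)
    (a₁ a₂ a₃ a₄ a₁₂ a₁₄ a₂₁ a₂₃ a₃₁ a₃₄ a₄₂ a₄₃ : ℕ)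
    (h₁₂ : 0 < a₁₂ ∧ a₁₂ < a₂) (h₁₄ : 0 < a₁₄ ∧ a₁₄ < a₄)
    (h₂₁ : 0 < a₂₁ ∧ a₂₁ < a₁) (h₂₃ : 0 < a₂₃ ∧ a₂₃ < a₃)
    (h₃₁ : 0 < a₃₁ ∧ a₃₁ < a₁) (h₃₄ : 0 < a₃₄ ∧ a₃₄ < a₄)
    (h₄₂ : 0 < a₄₂ ∧ a₄₂ < a₂) (h₄₃ : 0 < a₄₃ ∧ a₄₃ < a₃)
    -- the variables `x₁, x₂, x₃, x₄` are `X 0, X 1, X 2, X 3`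
    (hI : MonomialCurve.toricIdeal K n = Ideal.span
      {(X 0 ^ a₁ - X 1 ^ a₁₂ * X 3 ^ a₁₄ : MvPolynomial (Fin 4) K),
        X 1 ^ a₂ - X 0 ^ a₂₁ * X 2 ^ a₂₃,
        X 2 ^ a₃ - X 0 ^ a₃₁ * X 3 ^ a₃₄,
        X 3 ^ a₄ - X 1 ^ a₄₂ * X 2 ^ a₄₃,
        X 0 ^ a₃₁ * X 1 ^ a₄₂ - X 2 ^ a₂₃ * X 3 ^ a₁₄}) :
    MonomialCurve.HasCohenMacaulayTangentCone K n ↔ a₂ ≤ a₂₁ + a₂₃ ∧ a₃ ≤ a₃₁ + a₃₄ := by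
  have g₁ : (X 0 ^ a₁ - X 1 ^ a₁₂ * X 3 ^ a₁₄ : MvPolynomial (Fin 4) K) =
      monomial (expVec a₁ 0 0 0) 1 - monomial (expVec 0 a₁₂ 0 a₁₄) 1 := by
    simp [monomial_expVec]
  have g₂ : (X 1 ^ a₂ - X 0 ^ a₂₁ * X 2 ^ a₂₃ : MvPolynomial (Fin 4) K) =
      monomial (expVec 0 a₂ 0 0) 1 - monomial (expVec a₂₁ 0 a₂₃ 0) 1 := by
    simp [monomial_expVec]
  have g₃ : (X 2 ^ a₃ - X 0 ^ a₃₁ * X 3 ^ a₃₄ : MvPolynomial (Fin 4) K) =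
      monomial (expVec 0 0 a₃ 0) 1 - monomial (expVec a₃₁ 0 0 a₃₄) 1 := by
    simp [monomial_expVec]
  have g₄ : (X 3 ^ a₄ - X 1 ^ a₄₂ * X 2 ^ a₄₃ : MvPolynomial (Fin 4) K) =
      monomial (expVec 0 0 0 a₄) 1 - monomial (expVec 0 a₄₂ a₄₃ 0) 1 := by
    simp [monomial_expVec]
  have g₅ : (X 0 ^ a₃₁ * X 1 ^ a₄₂ - X 2 ^ a₂₃ * X 3 ^ a₁₄ : MvPolynomial (Fin 4) K) =
      monomial (expVec a₃₁ a₄₂ 0 0) 1 - monomial (expVec 0 0 a₂₃ a₁₄) 1 := by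
    simp [monomial_expVec]
  rw [g₁, g₂, g₃, g₄, g₅] at hI
  have weight : ∀ u v : Fin 4 →₀ ℕ, (monomial u 1 - monomial v 1 : MvPolynomial (Fin 4) K) ∈
      toricIdeal K n → expWeight n u = expWeight n v := fun u v h =>
    monomial_sub_monomial_mem_toricIdeal_iff.1 h
  have w₁ := weight (expVec a₁ 0 0 0) (expVec 0 a₁₂ 0 a₁₄)
    (by rw [hI]; exact Ideal.subset_span (by simp))
  have w₂ := weight (expVec 0 a₂ 0 0) (expVec a₂₁ 0 a₂₃ 0)
    (by rw [hI]; exact Ideal.subset_span (by simp))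
  have w₃ := weight (expVec 0 0 a₃ 0) (expVec a₃₁ 0 0 a₃₄)
    (by rw [hI]; exact Ideal.subset_span (by simp))
  have w₄ := weight (expVec 0 0 0 a₄) (expVec 0 a₄₂ a₄₃ 0)
    (by rw [hI]; exact Ideal.subset_span (by simp))
  have w₅ := weight (expVec a₃₁ a₄₂ 0 0) (expVec 0 0 a₂₃ a₁₄)
    (by rw [hI]; exact Ideal.subset_span (by simp))
  simp only [expWeight_expVec, zero_mul, add_zero, zero_add] at w₁ w₂ w₃ w₄ w₅
  have hmin : ∀ i, i ≠ 0 → n 0 < n i := fun i hi => hmono (Fin.pos_of_ne_zero hi)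
  rw [hasCohenMacaulayTangentCone_iff hpos hmin,
    ← isLongest_add_iff (hpos 0) (hmono (by decide : (0 : Fin 4) < 1))
      (hmono (by decide : (1 : Fin 4) < 2)) (hmono (by decide : (2 : Fin 4) < 3))
      h₁₂ h₁₄ h₂₁ h₂₃ h₃₁ h₃₄ h₄₂ h₄₃ w₁ w₂ w₃ w₄ w₅]
  · have hsingle : Finsupp.single (0 : Fin 4) 1 = expVec 1 0 0 0 :=
      (eq_expVec _).trans (by simp)
    rw [hsingle]
    constructor
    · intro h i j k l hl
      have := h (expVec i j k l) ((isMaximalExp_expVec_iff n i j k l).2 hl)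
      rwa [expVec_add, isMaximalExp_expVec_iff] at this
    · intro h u hu
      rw [eq_expVec u, isMaximalExp_expVec_iff] at hu
      rw [eq_expVec u, expVec_add, isMaximalExp_expVec_iff]
      exact h _ _ _ _ hu
  -- Equal weight puts the difference of the two monomials in the ideal generated by the five
  -- binomials, along which `P` is constant.
  · intro P hP i j k l i' j' k' l' hw hPu
    have hmem : (monomial (expVec i j k l) 1 - monomial (expVec i' j' k' l') 1 :
        MvPolynomial (Fin 4) K) ∈ toricIdeal K n :=
      monomial_sub_monomial_mem_toricIdeal_iff.2 (by rw [expWeight_expVec, expWeight_expVec, hw])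
    rw [hI] at hmem
    refine (mem_iff_mem_of_binomial_mem_span
      (A := {u : Fin 4 →₀ ℕ | P (u 0) (u 1) (u 2) (u 3)}) ?_ hmem).1 hPu
    rintro b (rfl | rfl | rfl | rfl | rfl)
    · exact ⟨_, _, rfl, fun m => hP.f₁ (m 0) (m 1) (m 2) (m 3)⟩
    · exact ⟨_, _, rfl, fun m => hP.f₂ (m 0) (m 1) (m 2) (m 3)⟩
    · exact ⟨_, _, rfl, fun m => hP.f₃ (m 0) (m 1) (m 2) (m 3)⟩
    · exact ⟨_, _, rfl, fun m => hP.f₄ (m 0) (m 1) (m 2) (m 3)⟩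
    · exact ⟨_, _, rfl, fun m => hP.f₅ (m 0) (m 1) (m 2) (m 3)⟩
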